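/- For a graph $G$, a $3$-coloring of $E(G)$ is an arbitrary (not necessarily proper) map assigning one of $3$ fixed colors to each edge of $G$. Let $\widehat{F}_3$ denote the rainbow triangle, that is, the pattern of $K_3$ in which the three edges have pairwise different colors, and let $c_{3,\widehat{F}_3}(G)$ be the number of $3$-colorings of $E(G)$ for which $G$ contains no triangle whose three edges receive pairwise different colors. All graphs are finite and simple. (a) For every $\delta>0$ there exists $n_0$ such that every graph $G$ on $n>n_0$ vertices satisfies $c_{3,\widehat{F}_3}(G)\le 2^{(1+\delta)n^2/2}$. (b) For every $\xi>0$ there exists $n_1$ such that every graph $G$ on $n>n_1$ vertices with $c_{3,\widehat{F}_3}(G)\ge 2^{\binom n2}$ satisfies $|E(G)|\ge \binom n2-\xi n^2$. -/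

import Mathlib

/-- A (color) pattern on a graph `F`: a partition of the edge set of `F`, given as an
equivalence relation on the edges. -/
abbrev ColorPattern {W : Type*} (F : SimpleGraph W) := Setoid F.edgeSet

/-- The edge coloring `C` of `G` contains the pattern `P` of `F`: there is a copy of `F` in `G`
(not necessarily induced) such that two edges of `F` lie in the same class of `P` if and only if
their images have the same color, that is, the partition of the copy into color classes is
isomorphic to `P`. The names of the colors play no role. -/
def ContainsPattern {V W K : Type*} {G : SimpleGraph V} {F : SimpleGraph W}
    (C : G.EdgeLabeling K) (P : ColorPattern F) : Prop :=
  ∃ f : SimpleGraph.Copy F G, ∀ e e' : F.edgeSet,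
    P e e' ↔ C (f.toHom.mapEdgeSet e) = C (f.toHom.mapEdgeSet e')

/-- The number of (not necessarily proper) `r`-colorings of the edges of `G` that do not contain
the pattern `P`. -/
noncomputable def numGoodColorings {V W : Type*} (r : ℕ) {F : SimpleGraph W}
    (P : ColorPattern F) (G : SimpleGraph V) : ℕ :=
  Nat.card {C : G.EdgeLabeling (Fin r) // ¬ ContainsPattern C P}

/-- The rainbow triangle: the pattern of `K₃` in which every class is a single edge. -/
abbrev rainbowTriangle : ColorPattern (⊤ : SimpleGraph (Fin 3)) := ⊥

/-!
The bound behind both parts is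
`log₂ c(G) ≤ (4 * (n.choose 2) + |E(G)|) / 5 + o(n²)`, where `c(G)` is the number of 3-colorings of
the edges of `G` without a rainbow triangle (`numGoodColorings_rainbowTriangle_le`). Since
`|E(G)| ≤ n.choose 2`, it gives the upper bound of the first part; and if `c(G) ≥ 2 ^ (n.choose 2)`,
it forces `|E(G)| ≥ n.choose 2 - o(n²)`.

The proof of the bound (`card_gallaiColorings_le`) is an induction on `n` by deleting two vertices.
Call a common neighbour `w` of `a` and `b` a distinguisher of `a` and `b` if the edges `wa` and `wb`
have different colors; the edge `ab`, if present, then has one of these two colors. Fix a threshold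
`t`, slightly above `√n`.

* Colorings in which every edge has at least `t` distinguishers: some set of `k`, of order
  `√n log n`, vertices contains a distinguisher of every edge (`exists_tuple_hitting`). Once the
  `2 ^ o(n²)` possible colorings of the edges at these vertices are fixed, every edge has at most two
  possible colors, so there are at most `2 ^ (|E(G)| + o(n²))` such colorings
  (`card_gallaiColorings_separated_le`).
* Colorings in which an edge `ab` has at most `t` distinguishers: a coloring of `G - a - b`
  extends in at most `3 ^ (n - 1) * (3 * n) ^ t` ways, because the edges `wa` and `wb` have the same
  color up to at most `t` exceptions `w` (`card_gallaiColorings_twin_le`).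

In the second case, `(4 / 5) * (n.choose 2)` drops by about `8 * n / 5`, and `3 ≤ 2 ^ (8 / 5)`,
so the deletion is paid for up to a factor `2 ^ o(n)`, which occurs at most `n / 2` times. That this
inequality holds with a coefficient of `n.choose 2` below `1` is what leaves room for the term
`|E(G)| / 5`, and hence gives the stability of the second part.
-/

open Finset

/-! ### Colorings as functions of two vertices -/

open Classical in
/-- The 3-colorings of the edges of `G` without a rainbow triangle, as symmetric functions of two
vertices, with the value `0` at the pairs that are not edges. -/
noncomputable def gallaiColorings {V : Type*} [Fintype V] (G : SimpleGraph V) :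
    Finset (V → V → Fin 3) :=
  {f | (∀ u v, f u v = f v u) ∧ (∀ u v, ¬ G.Adj u v → f u v = 0) ∧
    ∀ u v w, G.Adj u v → G.Adj v w → G.Adj u w →
      f u v = f v w ∨ f v w = f u w ∨ f u v = f u w}

theorem mem_gallaiColorings {V : Type*} [Fintype V] {G : SimpleGraph V} {f : V → V → Fin 3} :
    f ∈ gallaiColorings G ↔ (∀ u v, f u v = f v u) ∧ (∀ u v, ¬ G.Adj u v → f u v = 0) ∧
      ∀ u v w, G.Adj u v → G.Adj v w → G.Adj u w →
        f u v = f v w ∨ f v w = f u w ∨ f u v = f u w := by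
  simp [gallaiColorings]

theorem containsPattern_rainbowTriangle {V K : Type*} {G : SimpleGraph V} {C : G.EdgeLabeling K}
    {u v w : V} (huv : G.Adj u v) (hvw : G.Adj v w) (huw : G.Adj u w)
    (h₁ : C ⟨s(u, v), huv⟩ ≠ C ⟨s(v, w), hvw⟩) (h₂ : C ⟨s(v, w), hvw⟩ ≠ C ⟨s(u, w), huw⟩)
    (h₃ : C ⟨s(u, v), huv⟩ ≠ C ⟨s(u, w), huw⟩) : ContainsPattern C rainbowTriangle := by
  have hadj : ∀ i j : Fin 3, i ≠ j → G.Adj (![u, v, w] i) (![u, v, w] j) := by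
    intro i j hij
    fin_cases i <;> fin_cases j <;>
      simp_all [huv.symm, hvw.symm, huw.symm]
  refine ⟨⟨⟨![u, v, w], fun {i j} h => hadj i j h⟩, ?_⟩, ?_⟩
  · intro i j hij
    by_contra h
    exact (hadj i j h).ne hij
  · have key : ∀ e : (⊤ : SimpleGraph (Fin 3)).edgeSet,
        e.1 = s(0, 1) ∨ e.1 = s(1, 2) ∨ e.1 = s(0, 2) := by
      rintro ⟨e, he⟩
      induction e with | _ i j
      rw [SimpleGraph.mem_edgeSet, SimpleGraph.top_adj] at he
      revert he
      revert i j
      decide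
    intro e e'
    refine ⟨fun h => by rw [show e = e' from h], fun h => ?_⟩
    change e = e'
    rcases e with ⟨e, he⟩
    rcases e' with ⟨e', he'⟩
    rcases key ⟨e, he⟩ with h1 | h1 | h1 <;> rcases key ⟨e', he'⟩ with h2 | h2 | h2 <;>
      simp only at h1 h2 <;> subst h1 <;> subst h2 <;> first
      | rfl
      | exact absurd h h₁
      | exact absurd h h₂
      | exact absurd h h₃
      | exact absurd h.symm h₁
      | exact absurd h.symm h₂
      | exact absurd h.symm h₃

open Classical in
theorem numGoodColorings_le_card_gallaiColorings {V : Type*} [Fintype V] (G : SimpleGraph V) :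
    numGoodColorings 3 rainbowTriangle G ≤ #(gallaiColorings G) := by
  have hmem : ∀ C : {C : G.EdgeLabeling (Fin 3) // ¬ ContainsPattern C rainbowTriangle},
      (fun u v => if h : G.Adj u v then C.1 ⟨s(u, v), h⟩ else 0) ∈ gallaiColorings G := by
    rintro ⟨C, hC⟩
    rw [mem_gallaiColorings]
    refine ⟨fun u v => ?_, fun u v h => by simp [h], fun u v w huv hvw huw => ?_⟩
    · by_cases h : G.Adj u v
      · simp only [h, h.symm, dif_pos, Sym2.eq_swap]
      · have h' : ¬ G.Adj v u := fun h' => h h'.symm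
        simp [h, h']
    · by_contra! hne
      simp only [huv, hvw, huw, dif_pos] at hne
      exact hC (containsPattern_rainbowTriangle huv hvw huw hne.1 hne.2.1 hne.2.2)
  have hinj : Function.Injective
      (fun C => (⟨_, hmem C⟩ : {f // f ∈ gallaiColorings G})) := by
    rintro ⟨C, hC⟩ ⟨C', hC'⟩ h
    simp only [Subtype.mk.injEq] at h
    refine Subtype.ext (funext fun e => ?_)
    rcases e with ⟨e, he⟩
    induction e with | _ u v
    have := congrFun (congrFun h u) v
    have he' : G.Adj u v := he
    simpa only [he', dif_pos] using this
  have := Nat.card_le_card_of_injective _ hinj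
  simpa [numGoodColorings] using this

/-! ### Colorings in which every edge has many distinguishers -/

open Classical in
/-- The common neighbours of `a` and `b` that tell them apart in the coloring `f`. In a coloring
without a rainbow triangle, each of them leaves only two colors for the edge `ab`. -/
noncomputable def distinguishers {V : Type*} [Fintype V] (G : SimpleGraph V)
    (f : V → V → Fin 3) (a b : V) : Finset V :=
  {w | G.Adj a w ∧ G.Adj b w ∧ f a w ≠ f b w}

theorem mem_distinguishers {V : Type*} [Fintype V] {G : SimpleGraph V} {f : V → V → Fin 3}
    {a b w : V} : w ∈ distinguishers G f a b ↔ G.Adj a w ∧ G.Adj b w ∧ f a w ≠ f b w := by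
  simp [distinguishers]

open Classical in
/-- The rows of the coloring at the vertices `S i` confine the color of every edge to two values,
so that one bit per edge determines the rest of the coloring. -/
theorem card_gallaiColorings_hit_le {V : Type*} [Fintype V] (G : SimpleGraph V) {k : ℕ}
    (S : Fin k → V) :
    #{f ∈ gallaiColorings G | ∀ a b, G.Adj a b → ∃ i, S i ∈ distinguishers G f a b} ≤
      3 ^ (k * Fintype.card V) * 2 ^ G.edgeSet.ncard := by
  -- `pick r a b` is the index of a vertex that separates `a` from `b`; it depends on the rows only.
  have hpick : ∀ (r : Fin k → V → Fin 3) (a b : V), ∃ o : Option (Fin k),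
      (∃ i, G.Adj a (S i) ∧ G.Adj b (S i) ∧ r i a ≠ r i b) →
        ∃ i, o = some i ∧ G.Adj a (S i) ∧ G.Adj b (S i) ∧ r i a ≠ r i b := by
    intro r a b
    by_cases h : ∃ i, G.Adj a (S i) ∧ G.Adj b (S i) ∧ r i a ≠ r i b
    · exact ⟨some h.choose, fun _ => ⟨_, rfl, h.choose_spec⟩⟩
    · exact ⟨none, fun h' => absurd h' h⟩
  choose pick hpick using hpick
  let code : (V → V → Fin 3) → (Fin k → V → Fin 3) × (G.edgeSet → Bool) := fun f =>
    (fun i => f (S i), fun e => decide (∃ i, pick (fun i => f (S i)) e.1.out.1 e.1.out.2 = some i ∧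
      f e.1.out.1 e.1.out.2 = f (S i) e.1.out.1))
  have hcard : Fintype.card ((Fin k → V → Fin 3) × (G.edgeSet → Bool)) =
      3 ^ (k * Fintype.card V) * 2 ^ G.edgeSet.ncard := by
    simp [Fintype.card_prod, Fintype.card_pi, ← pow_mul, mul_comm, Set.ncard_eq_toFinset_card']
  rw [← hcard, ← Finset.card_univ]
  refine Finset.card_le_card_of_injOn code (fun _ _ => by simp) ?_
  intro f hf g hg hfg
  simp only [coe_filter, Set.mem_ofPred_eq, mem_gallaiColorings] at hf hg
  obtain ⟨⟨fsymm, f0, fgal⟩, fhit⟩ := hf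
  obtain ⟨⟨gsymm, g0, ggal⟩, ghit⟩ := hg
  have hrow : (fun i => f (S i)) = fun i => g (S i) := congrArg Prod.fst hfg
  have hbit : ∀ e, (code f).2 e = (code g).2 e := congrFun (congrArg Prod.snd hfg)
  have main : ∀ e : G.edgeSet, f e.1.out.1 e.1.out.2 = g e.1.out.1 e.1.out.2 := by
    intro e
    have hb := hbit e
    have hadj : G.Adj e.1.out.1 e.1.out.2 := by
      rw [← SimpleGraph.mem_edgeSet, show s(e.1.out.1, e.1.out.2) = e.1 from Quot.out_eq _]
      exact e.2
    simp only [code] at hb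
    rw [← hrow] at hb
    generalize e.1.out.1 = a at *
    generalize e.1.out.2 = b at *
    obtain ⟨i, hi, hai, hbi, hne⟩ := hpick (fun i => f (S i)) a b (by
      obtain ⟨i, hi⟩ := fhit a b hadj
      rw [mem_distinguishers] at hi
      exact ⟨i, hi.1, hi.2.1, by rw [fsymm (S i) a, fsymm (S i) b]; exact hi.2.2⟩)
    have ha : f (S i) a = g (S i) a := congrFun (congrFun hrow i) a
    have hbb : f (S i) b = g (S i) b := congrFun (congrFun hrow i) b
    simp only [hi, Option.some.injEq, exists_eq_left', decide_eq_decide, ← ha] at hb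
    have hf := fgal a b (S i) hadj hbi hai
    have hg := ggal a b (S i) hadj hbi hai
    rw [fsymm b, fsymm a (S i)] at hf
    rw [gsymm b, gsymm a (S i), ← ha, ← hbb] at hg
    grind
  funext a b
  by_cases h : G.Adj a b
  · have hab := main ⟨s(a, b), h⟩
    have hout : s((s(a, b)).out.1, (s(a, b)).out.2) = s(a, b) := Quot.out_eq _
    rw [Sym2.eq_iff] at hout
    simp only at hab
    rcases hout with ⟨h1, h2⟩ | ⟨h1, h2⟩
    · rwa [h1, h2] at hab
    · rw [h1, h2] at hab
      rw [fsymm, gsymm, hab]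
  · rw [f0 a b h, g0 a b h]

open Classical in
/-- Averaging over all `k`-tuples: some tuple meets every member of a small family of large
sets. -/
theorem exists_tuple_hitting {V ι : Type*} [Fintype V] (E : Finset ι) (D : ι → Finset V)
    {t k : ℕ} (hD : ∀ e ∈ E, t ≤ #(D e))
    (h : #E * (Fintype.card V - t) ^ k < Fintype.card V ^ k) :
    ∃ S : Fin k → V, ∀ e ∈ E, ∃ i, S i ∈ D e := by
  by_contra! hcon
  have hcover : (univ : Finset (Fin k → V)) ⊆ E.biUnion fun e => Fintype.piFinset fun _ => (D e)ᶜ := by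
    intro S _
    obtain ⟨e, he, hS⟩ := hcon S
    simpa using ⟨e, he, hS⟩
  have h1 := (Finset.card_le_card hcover).trans Finset.card_biUnion_le
  have h2 : ∑ e ∈ E, #(Fintype.piFinset fun _ : Fin k => (D e)ᶜ) ≤
      ∑ e ∈ E, (Fintype.card V - t) ^ k := by
    refine Finset.sum_le_sum fun e he => ?_
    simp only [Fintype.card_piFinset, prod_const, card_compl, card_univ, Fintype.card_fin]
    exact Nat.pow_le_pow_left (Nat.sub_le_sub_left (hD e he) _) _
  simp only [card_univ, Fintype.card_pi, prod_const, Fintype.card_fin, sum_const, smul_eq_mul]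
    at h1 h2
  omega

open Classical in
theorem card_gallaiColorings_separated_le {V : Type*} [Fintype V] (G : SimpleGraph V) {t k : ℕ}
    (h : Fintype.card V ^ 2 * (Fintype.card V - t) ^ k < Fintype.card V ^ k) :
    #{f ∈ gallaiColorings G | ∀ a b, G.Adj a b → t ≤ #(distinguishers G f a b)} ≤
      Fintype.card V ^ k * (3 ^ (k * Fintype.card V) * 2 ^ G.edgeSet.ncard) := by
  have hsub : {f ∈ gallaiColorings G | ∀ a b, G.Adj a b → t ≤ #(distinguishers G f a b)} ⊆
      (univ : Finset (Fin k → V)).biUnion fun S =>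
        {f ∈ gallaiColorings G | ∀ a b, G.Adj a b → ∃ i, S i ∈ distinguishers G f a b} := by
    intro f hf
    rw [mem_filter] at hf
    obtain ⟨S, hS⟩ := exists_tuple_hitting (k := k) {p : V × V | G.Adj p.1 p.2}
      (fun p => distinguishers G f p.1 p.2) (t := t) (fun p hp => hf.2 _ _ (by simpa using hp))
      (lt_of_le_of_lt (Nat.mul_le_mul_right _ ((Finset.card_le_univ _).trans
        (by rw [Fintype.card_prod, sq]))) h)
    simp only [mem_biUnion, mem_univ, true_and, mem_filter]
    exact ⟨S, hf.1, fun a b hab => hS (a, b) (by simpa using hab)⟩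
  refine (Finset.card_le_card hsub).trans (Finset.card_biUnion_le.trans ?_)
  refine (Finset.sum_le_sum fun S _ => card_gallaiColorings_hit_le G S).trans ?_
  simp

/-! ### Colorings in which an edge has few distinguishers -/

open Classical in
/-- If few vertices tell `a` and `b` apart, the two edges from a further vertex to `a` and `b`
together have three instead of nine colorings, apart from the few exceptions. -/
theorem card_gallaiColorings_twin_le {V : Type*} [Fintype V] (G : SimpleGraph V) (t : ℕ)
    (a b : V) :
    #{f ∈ gallaiColorings G | #(distinguishers G f a b) ≤ t} ≤
      #(gallaiColorings (G.induce {w | w ≠ a ∧ w ≠ b})) *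
        (3 ^ (Fintype.card V - 1) * (3 * Fintype.card V) ^ t) := by
  have hσ : ∀ f : V → V → Fin 3, ∃ σ : Fin t → V, #(distinguishers G f a b) ≤ t →
      ∀ w ∈ distinguishers G f a b, ∃ i, σ i = w := by
    intro f
    by_cases h : #(distinguishers G f a b) ≤ t
    · let e := (distinguishers G f a b).equivFin
      refine ⟨fun i => if hi : (i : ℕ) < #(distinguishers G f a b) then e.symm ⟨i, hi⟩ else a,
        fun _ w hw => ⟨⟨e ⟨w, hw⟩, (e ⟨w, hw⟩).2.trans_le h⟩, ?_⟩⟩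
      simp
    · exact ⟨fun _ => a, fun h' => absurd h' h⟩
  choose σ hσ using hσ
  -- The color of `ab` is stored at `b` in the table of common colors, which is indexed by `w ≠ a`.
  let code : (V → V → Fin 3) →
      ({w | w ≠ a ∧ w ≠ b} → {w | w ≠ a ∧ w ≠ b} → Fin 3) × ({w // w ≠ a} → Fin 3) ×
        (Fin t → Fin 3 × V) := fun f =>
    (fun u v => f u v, fun w => if G.Adj a w then f a w else f b w, fun i => (f b (σ f i), σ f i))
  have hcard : #(gallaiColorings (G.induce {w | w ≠ a ∧ w ≠ b})) *
        (3 ^ (Fintype.card V - 1) * (3 * Fintype.card V) ^ t) =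
      #(gallaiColorings (G.induce {w | w ≠ a ∧ w ≠ b}) ×ˢ
        (univ : Finset (({w // w ≠ a} → Fin 3) × (Fin t → Fin 3 × V)))) := by
    simp [card_product]
  rw [hcard]
  refine Finset.card_le_card_of_injOn code ?_ ?_
  · intro f hf
    simp only [coe_filter, Set.mem_ofPred_eq, mem_gallaiColorings] at hf
    obtain ⟨⟨h1, h2, h3⟩, -⟩ := hf
    simp only [coe_product, Set.mem_prod, mem_coe, mem_gallaiColorings, mem_univ, and_true, code]
    exact ⟨fun u v => h1 u v, fun u v h => h2 u v h, fun u v w => h3 u v w⟩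
  · intro f hf g hg hfg
    simp only [coe_filter, Set.mem_ofPred_eq, mem_gallaiColorings] at hf hg
    obtain ⟨⟨fsymm, f0, -⟩, ft⟩ := hf
    obtain ⟨⟨gsymm, g0, -⟩, gt⟩ := hg
    simp only [code, Prod.mk.injEq] at hfg
    obtain ⟨hrest, htab, hexc⟩ := hfg
    have hσeq : ∀ i, σ f i = σ g i := fun i => congrArg Prod.snd (congrFun hexc i)
    have hval : ∀ i, f b (σ f i) = g b (σ f i) := fun i => by
      have := congrArg Prod.fst (congrFun hexc i)
      rwa [← hσeq i] at this
    have htab' : ∀ w, w ≠ a → (if G.Adj a w then f a w else f b w) =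
        if G.Adj a w then g a w else g b w := fun w hw => congrFun htab ⟨w, hw⟩
    have hA : ∀ w, f a w = g a w := by
      intro w
      by_cases hw : G.Adj a w
      · simpa [hw] using htab' w hw.ne'
      · rw [f0 _ _ hw, g0 _ _ hw]
    have hB : ∀ w, f b w = g b w := by
      intro w
      by_cases hbw : G.Adj b w
      · by_cases hwa : w = a
        · rw [hwa, fsymm, gsymm, hA]
        by_cases haw : G.Adj a w
        · by_cases hex : ∃ i, σ f i = w
          · obtain ⟨i, rfl⟩ := hex
            exact hval i
          · have h1 : f a w = f b w := by
              by_contra hne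
              exact hex (hσ f ft w (mem_distinguishers.2 ⟨haw, hbw, hne⟩))
            have h2 : g a w = g b w := by
              by_contra hne
              obtain ⟨i, hi⟩ := hσ g gt w (mem_distinguishers.2 ⟨haw, hbw, hne⟩)
              exact hex ⟨i, (hσeq i).trans hi⟩
            rw [← h1, ← h2, hA]
        · simpa [haw] using htab' w hwa
      · rw [f0 _ _ hbw, g0 _ _ hbw]
    funext u v
    by_cases hua : u = a
    · rw [hua, hA]
    by_cases hub : u = b
    · rw [hub, hB]
    by_cases hva : v = a
    · rw [hva, fsymm, gsymm, hA]
    by_cases hvb : v = b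
    · rw [hvb, fsymm, gsymm, hB]
    exact congrFun (congrFun hrest ⟨u, hua, hub⟩) ⟨v, hva, hvb⟩

/-! ### The induction on the number of vertices -/

theorem ncard_edgeSet_induce_le {V : Type*} [Finite V] (G : SimpleGraph V) (s : Set V) :
    (G.induce s).edgeSet.ncard ≤ G.edgeSet.ncard := by
  rw [← Nat.card_coe_set_eq, ← Nat.card_coe_set_eq]
  exact Nat.card_le_card_of_injective _ (SimpleGraph.Embedding.induce s).mapEdgeSet.injective

theorem ncard_edgeSet_le_choose {V : Type*} [Fintype V] (G : SimpleGraph V) :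
    G.edgeSet.ncard ≤ (Fintype.card V).choose 2 := by
  classical
  have := G.card_edgeFinset_le_card_choose_two
  rwa [SimpleGraph.edgeFinset, ← Set.ncard_eq_toFinset_card'] at this

theorem four_mul_choose_two_add (m : ℕ) :
    4 * (m + 2).choose 2 = 4 * m.choose 2 + 8 * m + 4 := by
  have h1 : (m + 2).choose 2 = (m + 1) + (m + 1).choose 2 := by
    rw [Nat.choose_succ_succ' (m + 1) 1, Nat.choose_one_right]
  have h2 : (m + 1).choose 2 = m + m.choose 2 := by
    rw [Nat.choose_succ_succ' m 1, Nat.choose_one_right]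
  omega

open Classical in
/-- Either every edge has many distinguishers, or the two ends of some edge with few of them are
deleted. A deletion costs a factor `3 ^ n` up to lower order, while the exponent
`4 * (n.choose 2)` of `β` drops by about `8 * n`, and `3 ≤ β ^ 8`. -/
theorem card_gallaiColorings_le {β : ℝ} (hβ1 : 1 ≤ β) (hβ2 : β ^ 5 = 2) (hβ3 : 3 ≤ β ^ 8)
    {N t k : ℕ} (hN : 0 < N)
    (h : ∀ m, 0 < m → m ≤ N → m ^ 2 * (m - t) ^ k < m ^ k) (n : ℕ) (hn : n ≤ N) :
    ∀ (V : Type*) [Fintype V] (G : SimpleGraph V), Fintype.card V = n →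
      (#(gallaiColorings G) : ℝ) ≤ (N ^ k * 3 ^ (k * N)) * (1 + 3 * N ^ 2 * (3 * N) ^ t) ^ n *
        β ^ (4 * n.choose 2 + G.edgeSet.ncard) := by
  induction n using Nat.strong_induction_on with
  | _ n ih =>
  intro V _ G hV
  set A : ℝ := N ^ k * 3 ^ (k * N) with hA
  set L : ℝ := 1 + 3 * N ^ 2 * (3 * N) ^ t with hL
  have hN1 : (1 : ℝ) ≤ N := by exact_mod_cast hN
  have hA1 : 1 ≤ A := one_le_mul_of_one_le_of_one_le (one_le_pow₀ hN1) (one_le_pow₀ (by norm_num))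
  have hL1 : 1 ≤ L := le_add_of_nonneg_right (by positivity)
  rcases Nat.eq_zero_or_pos n with rfl | hpos
  · have : IsEmpty V := Fintype.card_eq_zero_iff.1 hV
    have h1 : #(gallaiColorings G) ≤ 1 := (Finset.card_le_univ _).trans (by simp)
    calc (#(gallaiColorings G) : ℝ) ≤ 1 := by exact_mod_cast h1
      _ ≤ _ := one_le_mul_of_one_le_of_one_le
        (one_le_mul_of_one_le_of_one_le hA1 (one_le_pow₀ hL1)) (one_le_pow₀ hβ1)
  set B : ℝ := β ^ (4 * n.choose 2 + G.edgeSet.ncard) with hB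
  have hB0 : 0 < B := by positivity
  have hsep : (#{f ∈ gallaiColorings G |
      ∀ a b, G.Adj a b → t ≤ #(distinguishers G f a b)} : ℝ) ≤ A * B := by
    have h1 := card_gallaiColorings_separated_le G (t := t) (k := k) (hV ▸ h n hpos hn)
    have h1' : (#{f ∈ gallaiColorings G |
      ∀ a b, G.Adj a b → t ≤ #(distinguishers G f a b)} : ℝ) ≤
        n ^ k * (3 ^ (k * n) * 2 ^ G.edgeSet.ncard) := by exact_mod_cast hV ▸ h1
    have h2 : (2 : ℝ) ^ G.edgeSet.ncard ≤ B := by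
      rw [← hβ2, ← pow_mul, hB]
      refine pow_le_pow_right₀ hβ1 ?_
      have := ncard_edgeSet_le_choose G
      rw [hV] at this
      omega
    have hnN : (n : ℝ) ≤ N := by exact_mod_cast hn
    calc _ ≤ _ := h1'
      _ = n ^ k * 3 ^ (k * n) * 2 ^ G.edgeSet.ncard := by ring
      _ ≤ A * B := by
        rw [hA]
        gcongr
        norm_num
  have htwin : ∀ p ∈ ({p : V × V | G.Adj p.1 p.2} : Finset (V × V)),
      (#{f ∈ gallaiColorings G | #(distinguishers G f p.1 p.2) ≤ t} : ℝ) ≤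
        A * L ^ (n - 1) * B * (3 * (3 * N) ^ t) := by
    rintro ⟨a, b⟩ hab
    have hab : G.Adj a b := by simpa using hab
    have hcard : Fintype.card {w | w ≠ a ∧ w ≠ b} = n - 2 := by
      rw [Fintype.card_ofFinset, ← hV, ← Finset.card_pair hab.ne, ← Finset.card_compl]
      congr 1
      ext w
      simp
    obtain ⟨m, rfl⟩ : ∃ m, n = m + 2 := by
      have : 1 < Fintype.card V := Fintype.one_lt_card_iff.2 ⟨a, b, hab.ne⟩
      exact ⟨n - 2, by omega⟩
    have hrec := ih m (by omega) (by omega) _ (G.induce {w | w ≠ a ∧ w ≠ b}) hcard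
    have h1 := card_gallaiColorings_twin_le G t a b
    rw [hV, show m + 2 - 1 = m + 1 by omega] at h1
    have h1' : (#{f ∈ gallaiColorings G | #(distinguishers G f a b) ≤ t} : ℝ) ≤
      #(gallaiColorings (G.induce {w | w ≠ a ∧ w ≠ b})) *
        (3 ^ (m + 1) * (3 * (m + 2 : ℕ)) ^ t) := by exact_mod_cast h1
    have hnN : ((m + 2 : ℕ) : ℝ) ≤ N := by exact_mod_cast hn
    have h3 : (3 : ℝ) ^ m * β ^ (4 * m.choose 2 + (G.induce {w | w ≠ a ∧ w ≠ b}).edgeSet.ncard)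
        ≤ B := by
      calc _ ≤ (β ^ 8) ^ m * β ^ (4 * m.choose 2 +
            (G.induce {w | w ≠ a ∧ w ≠ b}).edgeSet.ncard) := by gcongr
        _ = β ^ (8 * m + (4 * m.choose 2 +
            (G.induce {w | w ≠ a ∧ w ≠ b}).edgeSet.ncard)) := by rw [← pow_mul, ← pow_add]
        _ ≤ B := by
          refine pow_le_pow_right₀ hβ1 ?_
          have := four_mul_choose_two_add m
          have := ncard_edgeSet_induce_le G {w | w ≠ a ∧ w ≠ b}
          omega
    calc (#{f ∈ gallaiColorings G | #(distinguishers G f a b) ≤ t} : ℝ) ≤ _ := h1'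
      _ ≤ (A * L ^ m * β ^ (4 * m.choose 2 + (G.induce {w | w ≠ a ∧ w ≠ b}).edgeSet.ncard)) *
          (3 ^ (m + 1) * (3 * N) ^ t) := by gcongr
      _ = A * L ^ m * (3 ^ m * β ^ (4 * m.choose 2 +
          (G.induce {w | w ≠ a ∧ w ≠ b}).edgeSet.ncard)) * (3 * (3 * N) ^ t) := by ring
      _ ≤ A * L ^ (m + 1) * B * (3 * (3 * N) ^ t) := by
        gcongr
        exact Nat.le_succ m
  have hsub : gallaiColorings G ⊆
      {f ∈ gallaiColorings G | ∀ a b, G.Adj a b → t ≤ #(distinguishers G f a b)} ∪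
      ({p : V × V | G.Adj p.1 p.2} : Finset (V × V)).biUnion fun p =>
        {f ∈ gallaiColorings G | #(distinguishers G f p.1 p.2) ≤ t} := by
    intro f hf
    simp only [mem_union, mem_filter, mem_biUnion, hf, true_and, mem_univ, Prod.exists]
    by_contra! hcon
    obtain ⟨⟨a, b, hab, hlt⟩, h2⟩ := hcon
    exact absurd (h2 a b hab) (by omega)
  have hpairs : (#({p : V × V | G.Adj p.1 p.2} : Finset (V × V)) : ℝ) ≤ N ^ 2 := by
    have h1 : #({p : V × V | G.Adj p.1 p.2} : Finset (V × V)) ≤ N ^ 2 :=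
      (Finset.card_le_univ _).trans (by
        rw [Fintype.card_prod, hV, ← sq]
        exact Nat.pow_le_pow_left hn 2)
    exact_mod_cast h1
  have hsum : (#(gallaiColorings G) : ℝ) ≤
      #{f ∈ gallaiColorings G | ∀ a b, G.Adj a b → t ≤ #(distinguishers G f a b)} +
      ∑ p ∈ ({p : V × V | G.Adj p.1 p.2} : Finset (V × V)),
        (#{f ∈ gallaiColorings G | #(distinguishers G f p.1 p.2) ≤ t} : ℝ) := by
    exact_mod_cast (Finset.card_le_card hsub).trans ((Finset.card_union_le _ _).trans
      (Nat.add_le_add_left Finset.card_biUnion_le _))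
  have hLn : (1 : ℝ) ≤ L ^ (n - 1) := one_le_pow₀ hL1
  calc (#(gallaiColorings G) : ℝ) ≤ _ := hsum
    _ ≤ A * B + N ^ 2 * (A * L ^ (n - 1) * B * (3 * (3 * N) ^ t)) := by
      refine add_le_add hsep ((Finset.sum_le_sum htwin).trans ?_)
      rw [sum_const, nsmul_eq_mul]
      gcongr
    _ ≤ A * L ^ (n - 1) * B + N ^ 2 * (A * L ^ (n - 1) * B * (3 * (3 * N) ^ t)) := by
      gcongr
      exact le_mul_of_one_le_right (by positivity) hLn
    _ = A * (L ^ (n - 1) * L) * B := by rw [hL]; ring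
    _ = A * L ^ n * B := by rw [← pow_succ, Nat.sub_add_cancel hpos]

/-! ### Choice of the parameters and asymptotics -/

theorem pow_mul_add_le (x y n : ℕ) : x ^ n * (x + n * y) ≤ (x + y) ^ n * x := by
  induction n with
  | zero => simp
  | succ n ih =>
    calc x ^ (n + 1) * (x + (n + 1) * y) ≤ (x + y) * (x ^ n * (x + n * y)) := by
          rw [pow_succ]
          nlinarith [Nat.zero_le (x ^ n * (n * y * y))]
      _ ≤ (x + y) * ((x + y) ^ n * x) := Nat.mul_le_mul_left _ ih
      _ = (x + y) ^ (n + 1) * x := by ring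

/-- The form of `(1 - s / m) ^ s ≤ 1 / 2` for `m ≤ s ^ 2` that avoids division. -/
theorem two_mul_sub_pow_le {m s : ℕ} (hm : m ≤ s ^ 2) (hs : s < m) :
    2 * (m - s) ^ s ≤ m ^ s := by
  obtain ⟨x, rfl⟩ : ∃ x, m = x + s := ⟨m - s, by omega⟩
  have hx : 0 < x := by omega
  rw [Nat.add_sub_cancel]
  refine Nat.le_of_mul_le_mul_right ?_ hx
  calc 2 * x ^ s * x = x ^ s * (x + x) := by ring
    _ ≤ x ^ s * (x + s * s) := by gcongr; nlinarith
    _ ≤ _ := pow_mul_add_le x s s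

theorem sq_mul_sub_pow_lt {N s l m : ℕ} (hN : N ≤ s ^ 2) (hl : N ^ 2 < 2 ^ l) (hl0 : 0 < l)
    (hm : 0 < m) (hmN : m ≤ N) :
    m ^ 2 * (m - s) ^ (s * l) < m ^ (s * l) := by
  have hs0 : 0 < s := by
    rcases Nat.eq_zero_or_pos s with rfl | h
    · simp at hN; omega
    · exact h
  rcases le_or_gt m s with h | h
  · rw [Nat.sub_eq_zero_of_le h, zero_pow (by positivity), mul_zero]
    positivity
  · have hpos : 0 < (m - s) ^ (s * l) := Nat.pow_pos (by omega)
    calc m ^ 2 * (m - s) ^ (s * l) ≤ N ^ 2 * (m - s) ^ (s * l) := by gcongr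
      _ < 2 ^ l * (m - s) ^ (s * l) := Nat.mul_lt_mul_of_pos_right hl hpos
      _ = (2 * (m - s) ^ s) ^ l := by rw [mul_pow, pow_mul]
      _ ≤ (m ^ s) ^ l := Nat.pow_le_pow_left (two_mul_sub_pow_le (hmN.trans hN) h) l
      _ = _ := (pow_mul _ _ _).symm

/-- The lower order factor of the bound, for `s` above `√n` and `l` above `log₂ n`. -/
theorem lower_order_factor_le {n s l : ℕ} (hs : 1 ≤ s) (hl : 1 ≤ l) (hn : 1 ≤ n)
    (hnl : n < 2 ^ l) :
    (n ^ (s * (2 * l)) * 3 ^ (s * (2 * l) * n)) * (1 + 3 * n ^ 2 * (3 * n) ^ s) ^ n ≤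
      2 ^ (13 * (s * l ^ 2 * n)) := by
  have hn2 : n ≤ 2 ^ l := hnl.le
  have h3 : 3 ≤ 2 ^ 2 := by norm_num
  have hL : 1 + 3 * n ^ 2 * (3 * n) ^ s ≤ 2 ^ (2 + 2 * l + (2 + l) * s) := by
    calc 1 + 3 * n ^ 2 * (3 * n) ^ s ≤ n ^ 2 * (3 * n) ^ s + 3 * n ^ 2 * (3 * n) ^ s := by
          gcongr
          exact Nat.one_le_iff_ne_zero.2 (by positivity)
      _ = 2 ^ 2 * n ^ 2 * (3 * n) ^ s := by ring
      _ ≤ 2 ^ 2 * (2 ^ l) ^ 2 * (2 ^ 2 * 2 ^ l) ^ s := by gcongr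
      _ = _ := by rw [← pow_add, ← pow_mul, ← pow_mul, ← pow_add, ← pow_add]; congr 1; ring
  calc _ ≤ ((2 ^ l) ^ (s * (2 * l)) * (2 ^ 2) ^ (s * (2 * l) * n)) *
        (2 ^ (2 + 2 * l + (2 + l) * s)) ^ n := by gcongr
    _ = 2 ^ (l * (s * (2 * l)) + 2 * (s * (2 * l) * n) + (2 + 2 * l + (2 + l) * s) * n) := by
      rw [← pow_mul, ← pow_mul, ← pow_mul, ← pow_add, ← pow_add]
    _ ≤ _ := by
      refine Nat.pow_le_pow_right (by norm_num) ?_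
      have h1 : 1 ≤ l * 1 := by omega
      have e1 : s * l ^ 2 ≤ s * l ^ 2 * n := Nat.le_mul_of_pos_right _ hn
      have e2 : s * l ≤ s * l ^ 2 := by gcongr; nlinarith
      have e3 : s ≤ s * l := Nat.le_mul_of_pos_right _ hl
      have e4 : l ≤ s * l := Nat.le_mul_of_pos_left _ hs
      have e5 : s * l * n ≤ s * l ^ 2 * n := Nat.mul_le_mul_right _ e2
      have e6 : (2 + 2 * l + (2 + l) * s) * n ≤ (7 * (s * l)) * n := by
        refine Nat.mul_le_mul_right _ ?_
        nlinarith
      nlinarith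

open Filter Topology Asymptotics in
theorem eventually_sqrt_mul_log_sq_le {ε : ℝ} (hε : 0 < ε) :
    ∀ᶠ n : ℕ in atTop,
      13 * ((n.sqrt + 1 : ℕ) * (Nat.log 2 n + 1 : ℕ) ^ 2 : ℝ) ≤ ε * n := by
  have h1 : (fun x : ℝ => Real.log x ) =o[atTop] fun x => x ^ (1 / 8 : ℝ) :=
    isLittleO_log_rpow_atTop (by norm_num)
  have h2 : Tendsto (fun x : ℝ => x ^ (1 / 4 : ℝ)) atTop atTop :=
    tendsto_rpow_atTop (by norm_num)
  have h1' := (h1.bound (c := 1 / 2) (by norm_num)).natCast_atTop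
  have h2' := tendsto_natCast_atTop_atTop.eventually (h2.eventually_ge_atTop (104 / ε))
  have h3 : Tendsto (fun x : ℝ => x ^ (1 / 8 : ℝ)) atTop atTop :=
    tendsto_rpow_atTop (by norm_num)
  have h3' := tendsto_natCast_atTop_atTop.eventually (h3.eventually_ge_atTop 1)
  filter_upwards [h1', h2', h3', eventually_ge_atTop 1] with n hlog hbig hone hn
  have hn1 : (1 : ℝ) ≤ n := by exact_mod_cast hn
  have hn0 : (0 : ℝ) ≤ n := by positivity
  set y : ℝ := (n : ℝ) ^ (1 / 8 : ℝ) with hy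
  have hy2 : (n : ℝ) ^ (1 / 4 : ℝ) = y ^ 2 := by
    rw [hy, ← Real.rpow_natCast, ← Real.rpow_mul hn0]; norm_num
  have hy8 : (n : ℝ) = y ^ 8 := by
    rw [hy, ← Real.rpow_natCast, ← Real.rpow_mul hn0]; norm_num
  have hy0 : 0 ≤ y := by positivity
  have hs : ((n.sqrt + 1 : ℕ) : ℝ) ≤ 2 * y ^ 4 := by
    have h : ((n.sqrt : ℕ) : ℝ) ≤ y ^ 4 := by
      have : ((n.sqrt : ℕ) : ℝ) ^ 2 ≤ (y ^ 4) ^ 2 := by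
        rw [← pow_mul, ← hy8]
        exact_mod_cast Nat.sqrt_le' n
      exact le_of_pow_le_pow_left₀ two_ne_zero (by positivity) this
    have : 1 ≤ y ^ 4 := one_le_pow₀ hone
    push_cast
    linarith
  have hl : ((Nat.log 2 n + 1 : ℕ) : ℝ) ≤ 2 * y := by
    have hlog' : Real.log n ≤ 1 / 2 * y := by
      have := (le_abs_self _).trans hlog
      rwa [Real.norm_of_nonneg hy0] at this
    have h : (Nat.log 2 n : ℝ) * Real.log 2 ≤ Real.log n := by
      rw [← Real.log_pow]
      refine Real.log_le_log (by positivity) ?_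
      exact_mod_cast Nat.pow_log_le_self 2 (by omega)
    have := Real.log_two_gt_d9
    push_cast
    nlinarith [(Nat.cast_nonneg (Nat.log 2 n) : (0 : ℝ) ≤ _)]
  rw [hy2, div_le_iff₀ hε] at hbig
  calc 13 * ((n.sqrt + 1 : ℕ) * (Nat.log 2 n + 1 : ℕ) ^ 2 : ℝ) ≤
      13 * (2 * y ^ 4 * (2 * y) ^ 2) := by gcongr
    _ = 104 * y ^ 6 := by ring
    _ ≤ (y ^ 2 * ε) * y ^ 6 := by gcongr
    _ = ε * n := by rw [hy8]; ring

open Filter in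
/-- Both parts of the theorem follow by comparing the exponents in this bound. -/
theorem numGoodColorings_rainbowTriangle_le {ε : ℝ} (hε : 0 < ε) :
    ∃ n₀ : ℕ, ∀ (V : Type*) [Fintype V] (G : SimpleGraph V), n₀ < Fintype.card V →
      (numGoodColorings 3 rainbowTriangle G : ℝ) ≤
        2 ^ (ε * (Fintype.card V : ℝ) ^ 2 +
          (4 * (Fintype.card V).choose 2 + G.edgeSet.ncard) / 5 : ℝ) := by
  obtain ⟨n₀, hn₀⟩ := eventually_atTop.1 (eventually_sqrt_mul_log_sq_le hε)
  refine ⟨n₀, fun V _ G hV => ?_⟩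
  set n := Fintype.card V with hn
  have hn1 : 1 ≤ n := by omega
  have hnl : n < 2 ^ (Nat.log 2 n + 1) := Nat.lt_pow_succ_log_self (by norm_num) n
  set s := n.sqrt + 1 with hs
  set l := Nat.log 2 n + 1 with hl
  set β : ℝ := 2 ^ (1 / 5 : ℝ) with hβ
  have hβ5 : β ^ 5 = 2 := by
    rw [hβ, ← Real.rpow_natCast, ← Real.rpow_mul (by norm_num)]; norm_num
  have hβ1 : 1 ≤ β := Real.one_le_rpow (by norm_num) (by norm_num)
  -- `3 ^ 5 = 243 ≤ 256 = 2 ^ 8`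
  have hβ8 : 3 ≤ β ^ 8 := by
    refine le_of_pow_le_pow_left₀ (n := 5) (by norm_num) (by positivity) ?_
    rw [← pow_mul, mul_comm, pow_mul, hβ5]
    norm_num
  have hmain := card_gallaiColorings_le hβ1 hβ5 hβ8 (N := n) (t := s) (k := s * (2 * l)) hn1
    (fun m hm hmn => sq_mul_sub_pow_lt (Nat.lt_succ_sqrt' n).le
      (by rw [mul_comm 2 l, pow_mul]; exact Nat.pow_lt_pow_left hnl (by norm_num)) (by omega) hm hmn)
    n le_rfl V G hn.symm
  have hlow : ((n : ℝ) ^ (s * (2 * l)) * 3 ^ (s * (2 * l) * n)) *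
      (1 + 3 * n ^ 2 * (3 * n) ^ s) ^ n ≤ 2 ^ (13 * (s * l ^ 2 * n)) := by
    exact_mod_cast lower_order_factor_le (by omega) (by omega) hn1 hnl
  have hlow' : (2 : ℝ) ^ (13 * (s * l ^ 2 * n)) ≤ 2 ^ (ε * (n : ℝ) ^ 2) := by
    rw [← Real.rpow_natCast]
    refine Real.rpow_le_rpow_of_exponent_le (by norm_num) ?_
    have := mul_le_mul_of_nonneg_right (hn₀ n hV.le) (Nat.cast_nonneg (α := ℝ) n)
    rw [← hs, ← hl] at this
    rw [Nat.cast_mul, Nat.cast_mul, Nat.cast_mul, Nat.cast_pow, Nat.cast_ofNat]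
    linarith
  calc (numGoodColorings 3 rainbowTriangle G : ℝ) ≤ #(gallaiColorings G) := by
        exact_mod_cast numGoodColorings_le_card_gallaiColorings G
    _ ≤ _ := hmain
    _ ≤ 2 ^ (ε * (n : ℝ) ^ 2) * β ^ (4 * n.choose 2 + G.edgeSet.ncard) := by
      gcongr
      exact hlow.trans hlow'
    _ = _ := by
      rw [Real.rpow_add (by norm_num), hβ, ← Real.rpow_natCast (2 ^ (1 / 5 : ℝ)),
        ← Real.rpow_mul (by norm_num)]
      push_cast
      congr 2
      ring

theorem mainTheorem5 :
    (∀ δ : ℝ, 0 < δ → ∃ n₀ : ℕ, ∀ (V : Type*) [Fintype V] (G : SimpleGraph V),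
      n₀ < Fintype.card V →
        (numGoodColorings 3 rainbowTriangle G : ℝ) ≤
          (2 : ℝ) ^ ((1 + δ) * (Fintype.card V : ℝ) ^ 2 / 2)) ∧
    (∀ ξ : ℝ, 0 < ξ → ∃ n₁ : ℕ, ∀ (V : Type*) [Fintype V] (G : SimpleGraph V),
      n₁ < Fintype.card V →
      2 ^ (Fintype.card V).choose 2 ≤ numGoodColorings 3 rainbowTriangle G →
        ((Fintype.card V).choose 2 : ℝ) - ξ * (Fintype.card V : ℝ) ^ 2 ≤
          (G.edgeSet.ncard : ℝ)) := by
  constructor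
  · intro δ hδ
    obtain ⟨n₀, h⟩ := numGoodColorings_rainbowTriangle_le (half_pos hδ)
    refine ⟨n₀, fun V _ G hV => (h V G hV).trans ?_⟩
    refine Real.rpow_le_rpow_of_exponent_le (by norm_num) ?_
    have h1 : (G.edgeSet.ncard : ℝ) ≤ (Fintype.card V).choose 2 := by
      exact_mod_cast ncard_edgeSet_le_choose G
    rw [Nat.cast_choose_two] at h1 ⊢
    nlinarith [(Nat.cast_nonneg (Fintype.card V) : (0 : ℝ) ≤ _)]
  · intro ξ hξ
    obtain ⟨n₁, h⟩ := numGoodColorings_rainbowTriangle_le (show 0 < ξ / 5 by positivity)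
    refine ⟨n₁, fun V _ G hV hc => ?_⟩
    have h1 : (2 : ℝ) ^ ((Fintype.card V).choose 2 : ℝ) ≤
        numGoodColorings 3 rainbowTriangle G := by
      rw [Real.rpow_natCast]
      exact_mod_cast hc
    have h2 := (Real.rpow_le_rpow_left_iff (by norm_num)).1 (h1.trans (h V G hV))
    linarith
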